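/- Let $L$ be a frame with top $1$, bottom $0$ and pseudocomplement $x^*$. Write $a\prec b$ if $a^*\vee b=1$, and $a\prec\!\!\prec b$ if there is a family $(x_q)_{q\in\mathbb{Q}\cap[0,1]}$ in $L$ with $x_0=a$, $x_1=b$ and $x_p\prec x_q$ whenever $p<q$. Let $\mathrm{Coz}\,L$ be the set of cozero elements of $L$, i.e. of the joins $\bigvee_{n} a_n$ of sequences with $a_n\prec\!\!\prec a_{n+1}$ for all $n\in\mathbb{N}$, and let $CL$ be the Boolean algebra of complemented elements of $L$. Call $L$ strongly zero-dimensional if every element of $L$ is a join of elements of $CL$ and every cozero element is a join of countably many elements of $CL$. For $A\subseteq L$ put $\mathfrak{B}A=\{a^{**}: a\in A\}$; a frame $L$ is called coole if $\mathfrak{B}(\mathrm{Coz}\,L)=\mathfrak{B}L$. For a bounded meet-semilattice $A$, a subset $G\subseteq A$ is admissible if $\bigvee G$ exists and, for every $a\in A$, the join $\bigvee\{a\wedge y: y\in G\}$ exists and equals $a\wedge\bigvee G$. A D-ideal of $A$ is a downset containing the join of each of its admissible subsets. Let $D_\infty A$ be the frame of D-ideals of $A$, ordered by inclusion (a sublocale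 of the frame of all downsets of $A$), and let $D_\sigma A$ be the sub-$\sigma$-frame of $D_\infty A$ generated by the principal downsets ${\downarrow}a$, $a\in A$, i.e. the smallest subset containing them that contains the top and is closed under binary meets and countable (including empty) joins of $D_\infty A$. Finally, let $\lambda L$ be the frame of $\sigma$-ideals of $\mathrm{Coz}\,L$ (downsets of $\mathrm{Coz}\,L$ closed under countable joins, including the empty one), and $\beta L$ the frame of regular ideals of $L$ (ideals $I$ such that for each $x\in I$ there is $y\in I$ with $x\prec\!\!\prec y$), both ordered by inclusion. Theorem. For a strongly zero-dimensional frame $L$, the following are equivalent. 1. $L$ is coole. 2. $D_\sigma CL=D_\infty CL$. 3. $\mathfrak{B}(\mathrm{Coz}\,L)$, with the order inherited from $L$, is a frame. 4. $\lambda L$ is coole. 5. $\beta L$ is coole. -/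

import Mathlib

namespace FrameBases

universe u

/-! ### The rather below and completely below relations -/

section Below

variable {L : Type u} [Order.Frame L]

/-- `a ≺ b` (`a` is rather below `b`): `a* ∨ b = 1`, with `a*` the pseudocomplement of `a`. -/
def RatherBelow (a b : L) : Prop := aᶜ ⊔ b = ⊤

/-- `a ≺≺ b` (`a` is completely below `b`): there is a family `(x_q)` indexed by the rationals
`q` in `[0, 1]` with `x_0 = a`, `x_1 = b` and `x_p ≺ x_q` whenever `p < q`. (The values of `x`
at rationals outside `[0, 1]` are irrelevant.) -/
def CompletelyBelow (a b : L) : Prop :=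
  ∃ x : ℚ → L, x 0 = a ∧ x 1 = b ∧
    ∀ p q : ℚ, 0 ≤ p → p < q → q ≤ 1 → RatherBelow (x p) (x q)

theorem RatherBelow.mono {a a' b b' : L} (h : RatherBelow a b) (ha : a' ≤ a) (hb : b ≤ b') :
    RatherBelow a' b' :=
  top_le_iff.1 (h.symm.le.trans (sup_le_sup (compl_le_compl ha) hb))

theorem RatherBelow.sup {a a' b b' : L} (h : RatherBelow a b) (h' : RatherBelow a' b') :
    RatherBelow (a ⊔ a') (b ⊔ b') := by
  unfold RatherBelow at *
  rw [compl_sup, sup_inf_right, ← sup_assoc, h, sup_comm b, ← sup_assoc, h']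
  simp

theorem RatherBelow.inf {a a' b b' : L} (h : RatherBelow a b) (h' : RatherBelow a' b') :
    RatherBelow (a ⊓ a') (b ⊓ b') := by
  have h1 : RatherBelow (a ⊓ a') b := h.mono inf_le_left le_rfl
  have h2 : RatherBelow (a ⊓ a') b' := h'.mono inf_le_right le_rfl
  unfold RatherBelow at *
  rw [sup_inf_left, h1, h2, inf_idem]

theorem CompletelyBelow.mono {a a' b b' : L} (h : CompletelyBelow a b) (ha : a' ≤ a)
    (hb : b ≤ b') : CompletelyBelow a' b' := by
  obtain ⟨x, rfl, rfl, hx⟩ := h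
  refine ⟨fun q => if q = 0 then a' else if q = 1 then b' else x q, by simp, by simp, ?_⟩
  intro p q hp hpq hq
  refine (hx p q hp hpq hq).mono ?_ ?_
  · have : p ≠ 1 := (hpq.trans_le hq).ne
    by_cases h0 : p = 0
    · subst h0; simpa using ha
    · simp [h0, this]
  · have : q ≠ 0 := (hp.trans_lt hpq).ne'
    by_cases h1 : q = 1
    · subst h1; simpa using hb
    · simp [h1, this]

theorem CompletelyBelow.sup {a a' b b' : L} (h : CompletelyBelow a b)
    (h' : CompletelyBelow a' b') : CompletelyBelow (a ⊔ a') (b ⊔ b') := by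
  obtain ⟨x, rfl, rfl, hx⟩ := h
  obtain ⟨y, rfl, rfl, hy⟩ := h'
  exact ⟨fun q => x q ⊔ y q, rfl, rfl,
    fun p q hp hpq hq => (hx p q hp hpq hq).sup (hy p q hp hpq hq)⟩

theorem CompletelyBelow.inf {a a' b b' : L} (h : CompletelyBelow a b)
    (h' : CompletelyBelow a' b') : CompletelyBelow (a ⊓ a') (b ⊓ b') := by
  obtain ⟨x, rfl, rfl, hx⟩ := h
  obtain ⟨y, rfl, rfl, hy⟩ := h'
  exact ⟨fun q => x q ⊓ y q, rfl, rfl,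
    fun p q hp hpq hq => (hx p q hp hpq hq).inf (hy p q hp hpq hq)⟩

theorem CompletelyBelow.le {a b : L} (h : CompletelyBelow a b) : a ≤ b := by
  obtain ⟨x, rfl, rfl, hx⟩ := h
  have h1 : (x 0)ᶜ ⊔ x 1 = ⊤ := hx 0 1 le_rfl one_pos le_rfl
  calc x 0 = x 0 ⊓ ((x 0)ᶜ ⊔ x 1) := by rw [h1, inf_top_eq]
    _ ≤ x 1 := by rw [inf_sup_left]; simp

theorem completelyBelow_bot (b : L) : CompletelyBelow ⊥ b :=
  CompletelyBelow.mono ⟨fun _ => ⊥, rfl, rfl, fun _ _ _ _ _ => by simp [RatherBelow]⟩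
    le_rfl bot_le

theorem completelyBelow_top (a : L) : CompletelyBelow a ⊤ :=
  CompletelyBelow.mono ⟨fun _ => ⊤, rfl, rfl, fun _ _ _ _ _ => by simp [RatherBelow]⟩
    le_top le_rfl

end Below

/-! ### Sub-σ-frames -/

/-- A sub-σ-frame of a frame: a subset containing `1`, closed under binary meets and under
countable (possibly empty) joins. -/
structure SubSigmaFrame (L : Type u) [Order.Frame L] where
  carrier : Set L
  top_mem : ⊤ ∈ carrier
  inf_mem : ∀ a ∈ carrier, ∀ b ∈ carrier, a ⊓ b ∈ carrier
  sSup_mem : ∀ S ⊆ carrier, S.Countable → sSup S ∈ carrier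

/-- The sub-σ-frame generated by a subset: the intersection of all sub-σ-frames containing it. -/
def SubSigmaFrame.generate {L : Type u} [Order.Frame L] (B : Set L) : SubSigmaFrame L where
  carrier := {x | ∀ F : SubSigmaFrame L, B ⊆ F.carrier → x ∈ F.carrier}
  top_mem := fun F _ => F.top_mem
  inf_mem := fun a ha b hb F hF => F.inf_mem a (ha F hF) b (hb F hF)
  sSup_mem := fun S hS hc F hF => F.sSup_mem S (fun _ hx => hS hx F hF) hc

/-! ### Cozero elements -/

section Coz

variable (L : Type u) [Order.Frame L]

/-- `Coz L`: the elements `a = ⋁ aₙ` for some sequence with `aₙ ≺≺ aₙ₊₁` for all `n`. These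
form a sub-σ-frame of `L`. -/
def Coz : SubSigmaFrame L where
  carrier := {a | ∃ s : ℕ → L, (∀ n, CompletelyBelow (s n) (s (n + 1))) ∧ a = ⨆ n, s n}
  top_mem := ⟨fun _ => ⊤, fun _ => completelyBelow_top _, by simp⟩
  inf_mem := by
    rintro _ ⟨s, hs, rfl⟩ _ ⟨t, ht, rfl⟩
    refine ⟨fun n => s n ⊓ t n, fun n => (hs n).inf (ht n), ?_⟩
    exact (iSup_inf_of_monotone (monotone_nat_of_le_succ fun n => (hs n).le)
      (monotone_nat_of_le_succ fun n => (ht n).le)).symm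
  sSup_mem := by
    intro S hS hc
    rcases S.eq_empty_or_nonempty with rfl | hne
    · exact ⟨fun _ => ⊥, fun _ => completelyBelow_bot _, by simp⟩
    obtain ⟨f, rfl⟩ := hc.exists_eq_range hne
    have hf : ∀ i, ∃ s : ℕ → L, (∀ n, CompletelyBelow (s n) (s (n + 1))) ∧ f i = ⨆ n, s n :=
      fun i => hS ⟨i, rfl⟩
    choose s hs hfs using hf
    refine ⟨fun n => (Finset.range (n + 1)).sup fun i => s i n, fun n => ?_, ?_⟩
    · have key : ∀ F : Finset ℕ,
          CompletelyBelow (F.sup fun i => s i n) (F.sup fun i => s i (n + 1)) := by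
        intro F
        induction F using Finset.cons_induction with
        | empty => exact completelyBelow_bot _
        | cons i F hi ih => simpa using (hs i n).sup ih
      exact (key _).mono le_rfl
        (Finset.sup_mono (Finset.range_subset_range.2 (Nat.le_succ _)))
    · rw [sSup_range]
      apply le_antisymm
      · refine iSup_le fun i => ?_
        rw [hfs]
        refine iSup_le fun n => ?_
        have hm : Monotone (s i) := monotone_nat_of_le_succ fun n => (hs i n).le
        refine (hm (le_max_right i n)).trans (le_trans ?_ (le_iSup _ (max i n)))
        exact Finset.le_sup (f := fun j => s j (max i n))
          (Finset.mem_range.2 (Nat.lt_succ_of_le (le_max_left i n)))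
      · refine iSup_le fun n => Finset.sup_le fun i _ => ?_
        refine le_trans ?_ (le_iSup f i)
        rw [hfs]
        exact le_iSup (s i) n

end Coz

/-! ### Zero-dimensionality, Booleanization and coole frames -/

section Coole

variable (L : Type u) [Order.Frame L]

/-- `L` is zero-dimensional: the complemented elements form a base, i.e. every element is a join
of complemented elements. -/
def IsZeroDimensional : Prop :=
  ∀ x : L, ∃ S : Set L, (∀ c ∈ S, IsComplemented c) ∧ x = sSup S

/-- `L` is strongly zero-dimensional: it is zero-dimensional and every cozero element is a
countable join of complemented elements. -/
def IsStronglyZeroDimensional : Prop :=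
  IsZeroDimensional L ∧
    ∀ a ∈ (Coz L).carrier, ∃ S : Set L, S.Countable ∧ (∀ c ∈ S, IsComplemented c) ∧ a = sSup S

variable {L} in
/-- `𝔅 A = {a** : a ∈ A}` for a subset `A` of a frame. In particular `𝔅 L` (with `A = L`) is the
set of elements of the Booleanization of `L`, i.e. of those `x` with `x** = x`. -/
def boolz (A : Set L) : Set L := (fun a => aᶜᶜ) '' A

/-- `L` is coole: `𝔅 (Coz L) = 𝔅 L`. -/
def IsCoole : Prop := boolz (Coz L).carrier = boolz (Set.univ : Set L)

end Coole

/-- A partially ordered set is a frame in its own order: its order is the order of a frame, i.e.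
all joins exist and binary meets distribute over arbitrary joins. -/
def PosetIsFrame (P : Type u) [PartialOrder P] : Prop :=
  ∃ F : Order.Frame P, ∀ a b : P, F.le a b ↔ a ≤ b

/-! ### D-ideals -/

section DIdeals

variable {A : Type u} [SemilatticeInf A]

/-- `G` is admissible with join `g`: `g = ⋁ G`, and for each `a` the join `⋁ {a ∧ y : y ∈ G}`
exists and equals `a ∧ g`. -/
def IsAdmissible (G : Set A) (g : A) : Prop :=
  IsLUB G g ∧ ∀ a : A, IsLUB ((fun y => a ⊓ y) '' G) (a ⊓ g)

/-- A downset is a D-ideal if it contains the joins of all its admissible subsets. -/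
def IsDIdeal (E : LowerSet A) : Prop :=
  ∀ (G : Set A) (g : A), G ⊆ E → IsAdmissible G g → g ∈ E

variable (A) in
/-- `D∞ A`: the sublocale of the frame of downsets of `A` consisting of the D-ideals. As a
sublocale it is itself a frame (with the inclusion order). -/
def DInfty : Sublocale (LowerSet A) where
  carrier := {E | IsDIdeal E}
  sInf_mem' := by
    intro s hs G g hG hg
    rw [LowerSet.mem_sInf_iff]
    exact fun E hE => hs hE G g (fun x hx => LowerSet.mem_sInf_iff.1 (hG hx) E hE) hg
  himp_mem' := by
    intro E H hH G g hG hg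
    have mem_himp (a : A) : a ∈ E ⇨ H ↔ ∀ x ∈ E, a ⊓ x ∈ H := by
      rw [← LowerSet.Iic_le, le_himp_iff]
      constructor
      · intro h x hx
        exact h ⟨show a ⊓ x ≤ a from inf_le_left, E.lower inf_le_right hx⟩
      · rintro h x ⟨hxa, hxE⟩
        have := h x hxE
        rwa [inf_eq_right.2 (show x ≤ a from hxa)] at this
    rw [mem_himp]
    intro x hx
    rw [inf_comm]
    refine hH ((fun y => x ⊓ y) '' G) (x ⊓ g) ?_ ⟨hg.2 x, fun a => ?_⟩
    · rintro _ ⟨y, hy, rfl⟩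
      have := (mem_himp y).1 (hG hy) x hx
      rwa [inf_comm] at this
    · have := hg.2 (a ⊓ x)
      rw [Set.image_image]
      simpa only [inf_assoc] using this

/-- The embedding `a ↦ ↓a` of `A` into `D∞ A`. -/
def toDInfty (a : A) : DInfty A :=
  ⟨LowerSet.Iic a, fun _ _ hG hg => LowerSet.mem_Iic_iff.2
    (hg.1.2 fun _ hx => LowerSet.mem_Iic_iff.1 (hG hx))⟩

variable (A) in
/-- `D_σ A`: the sub-σ-frame of `D∞ A` generated by (the image of) `A`. -/
def DSigma : SubSigmaFrame (DInfty A) := SubSigmaFrame.generate (Set.range toDInfty)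

end DIdeals

/-! ### The Lindelöf coreflection `λL` -/

section Lindelof

variable {L : Type u} [Order.Frame L]

/-- A σ-ideal of a sub-σ-frame `A`: a downset of `A` closed under countable (possibly empty)
joins. -/
@[ext]
structure SigmaIdeal (A : SubSigmaFrame L) where
  carrier : Set L
  subset : carrier ⊆ A.carrier
  lower : ∀ x ∈ carrier, ∀ y ∈ A.carrier, y ≤ x → y ∈ carrier
  sSup_mem : ∀ S ⊆ carrier, S.Countable → sSup S ∈ carrier

namespace SigmaIdeal

variable {A : SubSigmaFrame L}

/-- σ-ideals are ordered by inclusion. -/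
instance : PartialOrder (SigmaIdeal A) :=
  PartialOrder.lift SigmaIdeal.carrier fun _ _ h => SigmaIdeal.ext h

theorem le_def {I J : SigmaIdeal A} : I ≤ J ↔ I.carrier ⊆ J.carrier := Iff.rfl

instance : InfSet (SigmaIdeal A) where
  sInf s :=
    { carrier := {x | x ∈ A.carrier ∧ ∀ I ∈ s, x ∈ I.carrier}
      subset := fun _ hx => hx.1
      lower := fun x hx y hy hyx => ⟨hy, fun I hI => I.lower x (hx.2 I hI) y hy hyx⟩
      sSup_mem := fun S hS hc => ⟨A.sSup_mem S (fun _ hx => (hS hx).1) hc,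
        fun I hI => I.sSup_mem S (fun _ hx => (hS hx).2 I hI) hc⟩ }

instance : Min (SigmaIdeal A) where
  min I J :=
    { carrier := I.carrier ∩ J.carrier
      subset := fun _ hx => I.subset hx.1
      lower := fun x hx y hy hyx => ⟨I.lower x hx.1 y hy hyx, J.lower x hx.2 y hy hyx⟩
      sSup_mem := fun S hS hc => ⟨I.sSup_mem S (fun _ hx => (hS hx).1) hc,
        J.sSup_mem S (fun _ hx => (hS hx).2) hc⟩ }

instance : CompleteLattice (SigmaIdeal A) where
  __ := completeLatticeOfInf (SigmaIdeal A) fun s =>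
    ⟨fun I hI _ hx => hx.2 I hI, fun J hJ x hx =>
      show x ∈ A.carrier ∧ ∀ I ∈ s, x ∈ I.carrier from ⟨J.subset hx, fun _ hI => hJ hI hx⟩⟩
  inf := (· ⊓ ·)
  inf_le_left := fun _ _ _ hx => hx.1
  inf_le_right := fun _ _ _ hx => hx.2
  le_inf := fun _ _ _ h h' _ hx => ⟨h hx, h' hx⟩

/-- The relative σ-ideal `{x ∈ A : x ∧ y ∈ J for all y ∈ I}`. -/
def residual (I J : SigmaIdeal A) : SigmaIdeal A where
  carrier := {x | x ∈ A.carrier ∧ ∀ y ∈ I.carrier, x ⊓ y ∈ J.carrier}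
  subset := fun _ hx => hx.1
  lower := fun x hx y hy hyx => ⟨hy, fun z hz =>
    J.lower _ (hx.2 z hz) _ (A.inf_mem _ hy _ (I.subset hz)) (inf_le_inf_right z hyx)⟩
  sSup_mem := fun S hS hc => ⟨A.sSup_mem S (fun _ hx => (hS hx).1) hc, fun y hy => by
    rw [sSup_inf_eq, ← sSup_image]
    refine J.sSup_mem _ ?_ (hc.image _)
    rintro _ ⟨x, hx, rfl⟩
    exact (hS hx).2 y hy⟩

instance : Order.Frame (SigmaIdeal A) := Order.Frame.ofMinimalAxioms
  { inf_sSup_le_iSup_inf := fun I s => by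
      have h : sSup s ≤ residual I (⨆ J ∈ s, I ⊓ J) := by
        refine sSup_le fun J hJ x hx => ⟨J.subset hx, fun y hy => ?_⟩
        have h1 : I ⊓ J ≤ ⨆ J ∈ s, I ⊓ J := le_iSup₂ (f := fun J _ => I ⊓ J) J hJ
        have hxy := A.inf_mem _ (J.subset hx) _ (I.subset hy)
        exact h1 ⟨I.lower _ hy _ hxy inf_le_right, J.lower _ hx _ hxy inf_le_left⟩
      intro x hx
      have := (h hx.2).2 x hx.1
      rwa [inf_idem] at this }

end SigmaIdeal

variable (L) in
/-- `λL`: the frame of σ-ideals of `Coz L`. -/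
abbrev Lindelofication : Type u := SigmaIdeal (Coz L)

end Lindelof

/-! ### The compact coreflection `βL` -/

section Compact

variable {L : Type u} [Order.Frame L]

/-- An ideal `I` of a frame is (completely) regular if each `x ∈ I` is completely below some
`y ∈ I`. -/
def IsRegularIdeal (I : Order.Ideal L) : Prop := ∀ x ∈ I, ∃ y ∈ I, CompletelyBelow x y

variable (L) in
/-- `βL`: the frame of regular ideals of `L`, ordered by inclusion. -/
def Compactification : Type u := {I : Order.Ideal L // IsRegularIdeal I}

namespace Compactification

instance : PartialOrder (Compactification L) := Subtype.partialOrder _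

theorem isRegularIdeal_sSup {s : Set (Order.Ideal L)} (hs : ∀ I ∈ s, IsRegularIdeal I) :
    IsRegularIdeal (sSup s) := by
  let M : Order.Ideal L :=
    { carrier := {x | ∃ y ∈ sSup s, CompletelyBelow x y}
      lower' := fun a b hba ⟨y, hy, h⟩ => ⟨y, hy, h.mono hba le_rfl⟩
      nonempty' := ⟨⊥, ⊥, Order.Ideal.bot_mem _, completelyBelow_bot _⟩
      directed' := fun a ⟨y, hy, h⟩ b ⟨z, hz, h'⟩ =>
        ⟨a ⊔ b, ⟨y ⊔ z, Order.Ideal.sup_mem hy hz, h.sup h'⟩, le_sup_left, le_sup_right⟩ }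
  have h : sSup s ≤ M := sSup_le fun I hI x hx => by
    obtain ⟨y, hy, hxy⟩ := hs I hI x hx
    exact ⟨y, (le_sSup hI : I ≤ sSup s) hy, hxy⟩
  exact fun x hx => h hx

instance : SupSet (Compactification L) where
  sSup s := ⟨sSup (Subtype.val '' s), isRegularIdeal_sSup (by
    rintro _ ⟨I, _, rfl⟩
    exact I.2)⟩

instance : Min (Compactification L) where
  min I J := ⟨I.1 ⊓ J.1, fun x hx => by
    obtain ⟨y, hy, hxy⟩ := I.2 x hx.1
    obtain ⟨z, hz, hxz⟩ := J.2 x hx.2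
    refine ⟨y ⊓ z, ⟨I.1.lower inf_le_left hy, J.1.lower inf_le_right hz⟩, ?_⟩
    simpa using hxy.inf hxz⟩

instance : CompleteLattice (Compactification L) where
  __ := completeLatticeOfSup (Compactification L) fun s =>
    ⟨fun I hI => (le_sSup (Set.mem_image_of_mem Subtype.val hI) :
        I.1 ≤ sSup (Subtype.val '' s)),
      fun J hJ => (sSup_le (by rintro _ ⟨I, hI, rfl⟩; exact hJ hI) :
        sSup (Subtype.val '' s) ≤ J.1)⟩
  inf := (· ⊓ ·)
  inf_le_left := fun I J => (inf_le_left : I.1 ⊓ J.1 ≤ I.1)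
  inf_le_right := fun I J => (inf_le_right : I.1 ⊓ J.1 ≤ J.1)
  le_inf := fun _ _ _ h h' => le_inf (α := Order.Ideal L) h h'

instance : Order.Frame (Compactification L) := Order.Frame.ofMinimalAxioms
  { inf_sSup_le_iSup_inf := fun I s => by
      let K : Order.Ideal L := (⨆ J ∈ s, I ⊓ J : Compactification L).1
      let M : Order.Ideal L :=
        { carrier := {x | ∀ i ∈ I.1, x ⊓ i ∈ K}
          lower' := fun a b hba ha i hi => K.lower (inf_le_inf_right i hba) (ha i hi)
          nonempty' := ⟨⊥, fun i _ => by rw [bot_inf_eq]; exact K.bot_mem⟩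
          directed' := fun a ha b hb => ⟨a ⊔ b, fun i hi => by
            rw [inf_sup_right]
            exact Order.Ideal.sup_mem (ha i hi) (hb i hi), le_sup_left, le_sup_right⟩ }
      have h : sSup (Subtype.val '' s) ≤ M := by
        refine sSup_le ?_
        rintro _ ⟨J, hJ, rfl⟩ x hx i hi
        have h1 : I ⊓ J ≤ ⨆ J ∈ s, I ⊓ J := le_iSup₂ (f := fun J _ => I ⊓ J) J hJ
        exact h1 ⟨I.1.lower inf_le_right hi, J.1.lower inf_le_left hx⟩
      intro x hx
      have := h hx.2 x hx.1
      rwa [inf_idem] at this }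

end Compactification

end Compact

end FrameBases

open FrameBases

/-!
Two elements `a`, `b` of a frame have the same double pseudocomplement iff `aᶜ = bᶜ`, so a frame is
coole iff each of its elements has the same pseudocomplement as some cozero element
(`isCoole_iff`). In a strongly zero-dimensional frame `L` the cozero elements are exactly the
countable joins of complemented elements, and each condition is compared with coolness of `L`.

* `D∞ (C L)` is the Booleanization of `L`: sending `a` to the D-ideal of complemented elements
  below `aᶜᶜ` is a surjective frame map (`regularDIdeal`) which identifies `a` and `b` iff
  `aᶜ = bᶜ`. It maps `Coz L` onto `D_σ (C L)` (`dSigma_carrier_eq`), so `D_σ (C L)` is everything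
  iff `L` is coole.
* If `L` is coole then `𝔅 (Coz L) = 𝔅 L` is a sublocale of `L`, hence a frame. Conversely, if
  `𝔅 (Coz L)` has all joins, then for `a` in `L` the join in `𝔅 (Coz L)` of the complemented
  elements below `a` must be `aᶜᶜ`: if a complemented `d` were below both this join and `aᶜ`,
  the meet of the join with `dᶜ` would still be an upper bound, whence `d = ⊥`.
* `I ↦ ⋁ I` is a dense frame map onto `L` from `λ L` and from `β L`, and it sends the principal
  ideal of a complemented element, which is complemented, to that element. A dense frame map along
  which complemented elements lift reflects and preserves equality of pseudocomplements and maps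
  cozero elements onto cozero elements, so it transfers coolness in both directions
  (`isCoole_iff_of_dense`).
-/

namespace FrameBases

universe u v

/-! ### Coolness and cozero elements -/

section Basic

variable {L : Type u} [Order.Frame L]

theorem isCoole_iff : IsCoole L ↔ ∀ x : L, ∃ c ∈ (Coz L).carrier, cᶜ = xᶜ := by
  constructor
  · intro h x
    have hx : xᶜᶜ ∈ boolz (Coz L).carrier := by
      rw [show boolz (Coz L).carrier = boolz Set.univ from h]
      exact ⟨x, trivial, rfl⟩
    obtain ⟨c, hc, hcx⟩ := hx
    exact ⟨c, hc, by simpa using congrArg compl hcx⟩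
  · intro h
    refine Set.Subset.antisymm (Set.image_mono (Set.subset_univ _)) ?_
    rintro _ ⟨x, -, rfl⟩
    obtain ⟨c, hc, hcx⟩ := h x
    exact ⟨c, hc, congrArg compl hcx⟩

theorem isCompl_compl_of_isComplemented {c : L} (hc : IsComplemented c) : IsCompl c cᶜ := by
  obtain ⟨d, h⟩ := hc
  exact h.compl_eq.symm ▸ h

theorem isComplemented_compl {c : L} (hc : IsComplemented c) : IsComplemented cᶜ :=
  ⟨c, (isCompl_compl_of_isComplemented hc).symm⟩

theorem compl_compl_of_isComplemented {c : L} (hc : IsComplemented c) : cᶜᶜ = c :=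
  (isCompl_compl_of_isComplemented hc).symm.compl_eq

theorem completelyBelow_self_of_isComplemented {c : L} (hc : IsComplemented c) :
    CompletelyBelow c c :=
  ⟨fun _ => c, rfl, rfl, fun _ _ _ _ _ =>
    (isCompl_compl_of_isComplemented hc).symm.sup_eq_top⟩

theorem mem_coz_of_isComplemented {c : L} (hc : IsComplemented c) : c ∈ (Coz L).carrier :=
  ⟨fun _ => c, fun _ => completelyBelow_self_of_isComplemented hc, by simp⟩

theorem IsZeroDimensional.le_of_forall (hz : IsZeroDimensional L) {x y : L}
    (h : ∀ c, IsComplemented c → c ≤ x → c ≤ y) : x ≤ y := by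
  obtain ⟨S, hS, rfl⟩ := hz x
  exact sSup_le fun c hc => h c (hS c hc) (le_sSup hc)

/-- In a zero-dimensional frame, the inequality `x ≤ aᶜᶜ` can be tested on complemented elements
disjoint from `a`. -/
theorem IsZeroDimensional.le_compl_compl (hz : IsZeroDimensional L) {x a : L}
    (h : ∀ d, IsComplemented d → d ≤ x → d ≤ aᶜ → d = ⊥) : x ≤ aᶜᶜ := by
  rw [le_compl_iff_disjoint_right, disjoint_iff_inf_le]
  exact hz.le_of_forall fun d hd hdx =>
    (h d hd (hdx.trans inf_le_left) (hdx.trans inf_le_right)).le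

end Basic

/-! ### Transfer of coolness along dense frame maps -/

section Dense

variable {M : Type u} {L : Type v} [Order.Frame M] [Order.Frame L]

theorem map_mem_coz (h : FrameHom M L) {a : M} (ha : a ∈ (Coz M).carrier) :
    h a ∈ (Coz L).carrier := by
  obtain ⟨s, hs, rfl⟩ := ha
  refine ⟨fun n => h (s n), fun n => ?_, map_iSup h s⟩
  obtain ⟨x, hx0, hx1, hx⟩ := hs n
  refine ⟨fun q => h (x q), by simp [hx0], by simp [hx1], fun p q hp hpq hq => ?_⟩
  have h1 : (x p)ᶜ ⊔ x q = ⊤ := hx p q hp hpq hq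
  have h2 : h (x p)ᶜ ≤ (h (x p))ᶜ := by
    rw [le_compl_iff_disjoint_right, disjoint_iff, ← map_inf, compl_inf_self, map_bot]
  have h3 : h (x p)ᶜ ⊔ h (x q) = ⊤ := by rw [← map_sup, h1, map_top]
  exact top_le_iff.1 (h3.symm.le.trans (sup_le_sup_right h2 _))

/-- Coolness transfers in both directions along a dense frame map to a strongly zero-dimensional
frame, if every complemented element is the image of a complemented element. -/
theorem isCoole_iff_of_dense (hL : IsStronglyZeroDimensional L) (h : FrameHom M L)
    (dense : ∀ a, h a = ⊥ → a = ⊥)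
    (lift : ∀ c : L, IsComplemented c → ∃ k : M, IsComplemented k ∧ h k = c) :
    IsCoole L ↔ IsCoole M := by
  choose! g hg using lift
  have map_sSup_lift : ∀ S : Set L, (∀ c ∈ S, IsComplemented c) → h (sSup (g '' S)) = sSup S := by
    intro S hS
    rw [map_sSup, Set.image_image]
    congr 1
    rw [Set.image_congr fun c hc => (hg c (hS c hc)).2, Set.image_id']
  have hsurj : Function.Surjective h := fun y => by
    obtain ⟨S, hS, rfl⟩ := hL.1 y
    exact ⟨_, map_sSup_lift S hS⟩
  have hdisj : ∀ a b, Disjoint (h a) (h b) ↔ Disjoint a b := fun a b => by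
    rw [disjoint_iff, disjoint_iff, ← map_inf]
    exact ⟨dense _, fun e => by rw [e, map_bot]⟩
  have hcompl : ∀ a, h aᶜ = (h a)ᶜ := fun a => by
    refine eq_of_forall_le_iff fun y => ?_
    obtain ⟨b, rfl⟩ := hsurj y
    constructor
    · exact fun hb => hb.trans
        (le_compl_iff_disjoint_right.2 ((hdisj _ _).2 disjoint_compl_left))
    · intro hb
      rw [le_compl_iff_disjoint_right, hdisj, ← le_compl_iff_disjoint_right] at hb
      exact OrderHomClass.mono h hb
  have hcompl_eq : ∀ a b, (h a)ᶜ = (h b)ᶜ ↔ aᶜ = bᶜ := by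
    refine fun a b => ⟨fun e => ?_, fun e => by rw [← hcompl, ← hcompl, e]⟩
    refine eq_of_forall_le_iff fun x => ?_
    rw [le_compl_iff_disjoint_right, ← hdisj, ← le_compl_iff_disjoint_right, e,
      le_compl_iff_disjoint_right, hdisj, ← le_compl_iff_disjoint_right]
  rw [isCoole_iff, isCoole_iff]
  constructor
  · intro hc x
    obtain ⟨d, hd, hdx⟩ := hc (h x)
    obtain ⟨S, hSc, hS, rfl⟩ := hL.2 d hd
    refine ⟨sSup (g '' S), (Coz M).sSup_mem _ ?_ (hSc.image g), ?_⟩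
    · rintro _ ⟨c, hc, rfl⟩
      exact mem_coz_of_isComplemented (hg c (hS c hc)).1
    · rw [← hcompl_eq, map_sSup_lift S hS, hdx]
  · intro hc y
    obtain ⟨x, rfl⟩ := hsurj y
    obtain ⟨c, hcz, hcx⟩ := hc x
    exact ⟨h c, map_mem_coz h hcz, (hcompl_eq _ _).2 hcx⟩

end Dense

/-! ### The Booleanization and D-ideals of complemented elements -/

section DIdeals

variable {L : Type u} [Order.Frame L]

/-- The D-ideal of all complemented elements below `aᶜᶜ`. As a map of `a` it is, up to
isomorphism, the quotient map of a zero-dimensional frame onto its Booleanization. -/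
def regularDIdeal (hz : IsZeroDimensional L) (a : L) : DInfty (Complementeds L) :=
  ⟨{ carrier := {c | (c : L) ≤ aᶜᶜ}
     lower' := fun _ _ hdc hc => le_trans (show _ from hdc) hc },
    fun G g hG hg => hz.le_compl_compl fun d hd hdg hda => by
      -- `dᶜ` bounds `G` from above, hence also its join `g`, which lies above `d`.
      have hub : g ≤ ⟨dᶜ, isComplemented_compl hd⟩ := hg.1.2 fun y hy => by
        have hy' : (y : L) ≤ aᶜᶜ := hG hy
        exact hy'.trans (compl_le_compl hda)
      exact le_compl_self.1 (hdg.trans hub)⟩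

theorem mem_regularDIdeal {hz : IsZeroDimensional L} {a : L} {c : Complementeds L} :
    c ∈ (regularDIdeal hz a).1 ↔ (c : L) ≤ aᶜᶜ := Iff.rfl

/-- The join in `L` of a D-ideal of complemented elements. -/
def dIdealSup (E : DInfty (Complementeds L)) : L :=
  sSup ((fun c : Complementeds L => (c : L)) '' {c | c ∈ E.1})

theorem le_dIdealSup {E : DInfty (Complementeds L)} {c : Complementeds L} (hc : c ∈ E.1) :
    (c : L) ≤ dIdealSup E :=
  le_sSup ⟨c, hc, rfl⟩

/-- A D-ideal `E` of complemented elements is determined by the regular element `(⋁ E)ᶜᶜ`. -/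
theorem mem_iff_le_dIdealSup {E : DInfty (Complementeds L)} {c : Complementeds L} :
    c ∈ E.1 ↔ (c : L) ≤ (dIdealSup E)ᶜᶜ := by
  refine ⟨fun hc => (le_dIdealSup hc).trans le_compl_compl, fun hc => ?_⟩
  -- `c` is the admissible join of the elements of `E` below it.
  have key : ∀ a : Complementeds L, IsLUB ((fun y => a ⊓ y) '' {e | e ∈ E.1 ∧ e ≤ c}) (a ⊓ c) := by
    refine fun a => ⟨?_, fun y hy => ?_⟩
    · rintro _ ⟨e, he, rfl⟩
      exact inf_le_inf_left a he.2
    · have hw : dIdealSup E ≤ ((a : L) ⊓ c ⊓ (y : L)ᶜ)ᶜ := by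
        refine sSup_le ?_
        rintro _ ⟨e, he, rfl⟩
        rw [le_compl_iff_disjoint_right, disjoint_iff_inf_le]
        have h1 : a ⊓ (c ⊓ e) ≤ y := hy ⟨c ⊓ e, ⟨E.1.lower inf_le_right he, inf_le_left⟩, rfl⟩
        have h2 : (a : L) ⊓ (c ⊓ e) ≤ y := h1
        calc (e : L) ⊓ (a ⊓ c ⊓ (y : L)ᶜ) = ((a : L) ⊓ (c ⊓ e)) ⊓ (y : L)ᶜ := by ac_rfl
          _ ≤ (y : L) ⊓ (y : L)ᶜ := inf_le_inf_right _ h2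
          _ ≤ ⊥ := (inf_compl_self _).le
      have hcw : (c : L) ≤ ((a : L) ⊓ c ⊓ (y : L)ᶜ)ᶜ := by
        simpa using hc.trans (compl_le_compl (compl_le_compl hw))
      have hbot : (a : L) ⊓ c ⊓ (y : L)ᶜ = ⊥ :=
        le_compl_self.1 ((inf_le_left.trans inf_le_right).trans hcw)
      have : (a : L) ⊓ c ≤ (y : L)ᶜᶜ := le_compl_iff_disjoint_right.2 (disjoint_iff.2 hbot)
      rw [compl_compl_of_isComplemented y.2] at this
      exact this
  exact E.2 {e | e ∈ E.1 ∧ e ≤ c} c (fun _ he => he.1) ⟨by simpa using key ⊤, key⟩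

theorem regularDIdeal_dIdealSup (hz : IsZeroDimensional L) (E : DInfty (Complementeds L)) :
    regularDIdeal hz (dIdealSup E) = E :=
  Subtype.ext <| SetLike.ext fun _ => mem_iff_le_dIdealSup.symm

theorem gc_regularDIdeal (hz : IsZeroDimensional L) :
    GaloisConnection (regularDIdeal hz) fun E => (dIdealSup E)ᶜᶜ := by
  refine fun a E => ⟨fun h => ?_, fun h c hc => ?_⟩
  · exact hz.le_of_forall fun c hc hca =>
      mem_iff_le_dIdealSup.1 (h (show (⟨c, hc⟩ : Complementeds L) ∈ (regularDIdeal hz a).1 from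
        hca.trans le_compl_compl))
  · refine mem_iff_le_dIdealSup.2 (le_trans (mem_regularDIdeal.1 hc) ?_)
    simpa using compl_le_compl (compl_le_compl h)

theorem regularDIdeal_eq_iff (hz : IsZeroDimensional L) {a b : L} :
    regularDIdeal hz a = regularDIdeal hz b ↔ aᶜ = bᶜ := by
  have key : ∀ {a b : L}, regularDIdeal hz a = regularDIdeal hz b → aᶜᶜ ≤ bᶜᶜ := fun {a b} h =>
    hz.le_of_forall fun c hc hca => by
      have : (⟨c, hc⟩ : Complementeds L) ∈ (regularDIdeal hz b).1 := h ▸ hca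
      exact this
  constructor
  · intro h
    simpa using congrArg compl (le_antisymm (key h) (key h.symm))
  · intro h
    refine Subtype.ext <| SetLike.ext fun c => ?_
    rw [mem_regularDIdeal, mem_regularDIdeal, h]

theorem regularDIdeal_coe (hz : IsZeroDimensional L) (c : Complementeds L) :
    regularDIdeal hz (c : L) = toDInfty c := by
  refine Subtype.ext <| SetLike.ext fun d => ?_
  rw [mem_regularDIdeal, compl_compl_of_isComplemented c.2]
  rfl

theorem regularDIdeal_inf (hz : IsZeroDimensional L) (a b : L) :
    regularDIdeal hz (a ⊓ b) = regularDIdeal hz a ⊓ regularDIdeal hz b := by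
  refine Subtype.ext <| SetLike.ext fun d => ?_
  rw [mem_regularDIdeal, compl_compl_inf_distrib, le_inf_iff]
  rfl

theorem regularDIdeal_sSup (hz : IsZeroDimensional L) (S : Set L) :
    regularDIdeal hz (sSup S) = sSup (regularDIdeal hz '' S) := by
  rw [(gc_regularDIdeal hz).l_sSup, sSup_image]

/-- `D_σ (C L)` corresponds to the cozero elements of `L`. -/
theorem dSigma_carrier_eq (hL : IsStronglyZeroDimensional L) :
    (DSigma (Complementeds L)).carrier = regularDIdeal hL.1 '' (Coz L).carrier := by
  apply Set.Subset.antisymm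
  · let F : SubSigmaFrame (DInfty (Complementeds L)) :=
      { carrier := regularDIdeal hL.1 '' (Coz L).carrier
        top_mem := ⟨⊤, (Coz L).top_mem, by
          refine Subtype.ext <| SetLike.ext fun d => ?_
          rw [mem_regularDIdeal]
          exact iff_of_true (by simp) trivial⟩
        inf_mem := by
          rintro _ ⟨a, ha, rfl⟩ _ ⟨b, hb, rfl⟩
          exact ⟨a ⊓ b, (Coz L).inf_mem a ha b hb, regularDIdeal_inf hL.1 a b⟩
        sSup_mem := by
          intro S hS hc
          choose! g hg using hS
          refine ⟨sSup (g '' S), (Coz L).sSup_mem _ ?_ (hc.image g), ?_⟩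
          · rintro _ ⟨E, hE, rfl⟩
            exact (hg hE).1
          · rw [regularDIdeal_sSup, Set.image_image,
              Set.image_congr fun E hE => (hg hE).2, Set.image_id'] }
    intro E hE
    refine hE F ?_
    rintro _ ⟨c, rfl⟩
    exact ⟨c, mem_coz_of_isComplemented c.2, regularDIdeal_coe hL.1 c⟩
  · rintro _ ⟨a, ha, rfl⟩
    obtain ⟨S, hSc, hS, rfl⟩ := hL.2 a ha
    rw [regularDIdeal_sSup]
    refine (DSigma (Complementeds L)).sSup_mem _ ?_ (hSc.image _)
    rintro _ ⟨c, hc, rfl⟩ F hF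
    exact hF ⟨⟨c, hS c hc⟩, (regularDIdeal_coe hL.1 ⟨c, hS c hc⟩).symm⟩

theorem isCoole_iff_dSigma (hL : IsStronglyZeroDimensional L) :
    IsCoole L ↔ (DSigma (Complementeds L)).carrier = Set.univ := by
  rw [isCoole_iff, dSigma_carrier_eq hL, Set.eq_univ_iff_forall]
  constructor
  · intro h E
    obtain ⟨c, hc, hcE⟩ := h (dIdealSup E)
    exact ⟨c, hc, ((regularDIdeal_eq_iff hL.1).2 hcE).trans (regularDIdeal_dIdealSup hL.1 E)⟩
  · intro h x
    obtain ⟨c, hc, hcx⟩ := h (regularDIdeal hL.1 x)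
    exact ⟨c, hc, (regularDIdeal_eq_iff hL.1).1 hcx⟩

end DIdeals

/-! ### The poset of double pseudocomplements of cozero elements -/

section Boolz

variable {L : Type u} [Order.Frame L]

theorem PosetIsFrame.exists_isLUB {P : Type u} [PartialOrder P] (h : PosetIsFrame P) (S : Set P) :
    ∃ s, IsLUB S s := by
  obtain ⟨F, hF⟩ := h
  refine ⟨F.sSup S, fun x hx => (hF _ _).1 ((F.isLUB_sSup S).1 hx), fun y hy => (hF _ _).1 ?_⟩
  exact (F.isLUB_sSup S).2 fun x hx => (hF _ _).2 (hy hx)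

variable (L) in
/-- The Booleanization of `L`, as a sublocale. -/
def booleanization : Sublocale L where
  carrier := boolz Set.univ
  sInf_mem' := by
    intro s hs
    refine ⟨sInf s, trivial, le_antisymm (le_sInf fun a ha => ?_) le_compl_compl⟩
    obtain ⟨b, -, rfl⟩ := hs ha
    simpa using compl_le_compl (compl_le_compl (sInf_le ha))
  himp_mem' := by
    rintro a _ ⟨b, -, rfl⟩
    refine ⟨(a ⊓ bᶜ)ᶜ, trivial, ?_⟩
    change (a ⊓ bᶜ)ᶜᶜᶜ = a ⇨ bᶜᶜ
    rw [compl_compl_compl, ← himp_bot bᶜ, himp_himp, himp_bot]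

theorem isCoole_iff_posetIsFrame (hz : IsZeroDimensional L) :
    IsCoole L ↔ PosetIsFrame (boolz (Coz L).carrier) := by
  constructor
  · intro h
    rw [show boolz (Coz L).carrier = boolz Set.univ from h]
    exact ⟨inferInstanceAs (Order.Frame (booleanization L)), fun _ _ => Iff.rfl⟩
  · intro h
    have inf_mem : ∀ x ∈ boolz (Coz L).carrier, ∀ y ∈ boolz (Coz L).carrier,
        x ⊓ y ∈ boolz (Coz L).carrier := by
      rintro _ ⟨a, ha, rfl⟩ _ ⟨b, hb, rfl⟩
      exact ⟨a ⊓ b, (Coz L).inf_mem a ha b hb, compl_compl_inf_distrib a b⟩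
    have compl_mem : ∀ c : L, IsComplemented c → c ∈ boolz (Coz L).carrier := fun c hc =>
      ⟨c, mem_coz_of_isComplemented hc, compl_compl_of_isComplemented hc⟩
    refine isCoole_iff.2 fun x => ?_
    obtain ⟨⟨s, hs⟩, hub, hlub⟩ :=
      h.exists_isLUB {p : boolz (Coz L).carrier | IsComplemented (p : L) ∧ (p : L) ≤ x}
    have hxs : x ≤ s := hz.le_of_forall fun c hc hcx =>
      hub (show (⟨c, compl_mem c hc⟩ : boolz (Coz L).carrier) ∈ _ from ⟨hc, hcx⟩)
    have hsx : s ≤ xᶜᶜ := hz.le_compl_compl fun d hd hds hdx => by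
      have hle : (⟨s, hs⟩ : boolz (Coz L).carrier) ≤
          ⟨dᶜ, compl_mem _ (isComplemented_compl hd)⟩ := hlub fun p hp =>
        hp.2.trans (le_compl_compl.trans (compl_le_compl hdx))
      exact le_compl_self.1 (hds.trans hle)
    obtain ⟨c, hc, rfl⟩ := hs
    refine ⟨c, hc, le_antisymm ?_ ?_⟩
    · simpa using compl_le_compl hxs
    · simpa using compl_le_compl hsx

end Boolz

/-! ### The Lindelöf coreflection -/

section Lindelof

variable {L : Type u} [Order.Frame L]

/-- The principal σ-ideal of all cozero elements below `a`. -/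
def sigmaIdealBelow (a : L) : Lindelofication L where
  carrier := {x | x ∈ (Coz L).carrier ∧ x ≤ a}
  subset := fun _ hx => hx.1
  lower := fun _ hx _ hy hyx => ⟨hy, hyx.trans hx.2⟩
  sSup_mem := fun S hS hc => ⟨(Coz L).sSup_mem S (fun _ hx => (hS hx).1) hc,
    sSup_le fun _ hx => (hS hx).2⟩

theorem gc_sSup_sigmaIdealBelow :
    GaloisConnection (fun I : Lindelofication L => sSup I.carrier) sigmaIdealBelow :=
  fun _ _ => ⟨fun h _ hx => ⟨SigmaIdeal.subset _ hx, (le_sSup hx).trans h⟩,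
    fun h => sSup_le fun _ hx => (h hx).2⟩

variable (L) in
/-- The dense frame map `λL → L`, `I ↦ ⋁ I`. -/
def lindeloficationHom : FrameHom (Lindelofication L) L where
  toFun I := sSup I.carrier
  map_inf' I J := by
    refine le_antisymm (le_inf (sSup_le_sSup fun _ hx => hx.1) (sSup_le_sSup fun _ hx => hx.2)) ?_
    rw [sSup_inf_sSup]
    refine iSup₂_le fun p hp => le_sSup ?_
    have hm := (Coz L).inf_mem _ (I.subset hp.1) _ (J.subset hp.2)
    exact ⟨I.lower _ hp.1 _ hm inf_le_left, J.lower _ hp.2 _ hm inf_le_right⟩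
  map_top' := top_le_iff.1 <| le_sSup <|
    (le_top : sigmaIdealBelow ⊤ ≤ (⊤ : Lindelofication L)) ⟨(Coz L).top_mem, le_rfl⟩
  map_sSup' s := by rw [gc_sSup_sigmaIdealBelow.l_sSup, sSup_image]

theorem isComplemented_sigmaIdealBelow {c : L} (hc : IsComplemented c) :
    IsComplemented (sigmaIdealBelow c) := by
  refine ⟨sigmaIdealBelow cᶜ, disjoint_iff_inf_le.2 fun x hx => ?_, fun K h1 h2 x hx => ?_⟩
  · obtain rfl : x = ⊥ := le_bot_iff.1 <| (le_inf hx.1.2 hx.2.2).trans (inf_compl_self c).le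
    simpa using (⊥ : Lindelofication L).sSup_mem ∅ (Set.empty_subset _) Set.countable_empty
  · have hx' : x ∈ (Coz L).carrier := SigmaIdeal.subset _ hx
    have h : x = sSup {x ⊓ c, x ⊓ cᶜ} := by
      rw [sSup_pair, ← inf_sup_left, (isCompl_compl_of_isComplemented hc).sup_eq_top, inf_top_eq]
    rw [h]
    refine K.sSup_mem _ ?_ (Set.toFinite _).countable
    rintro _ (rfl | rfl)
    · exact h1 ⟨(Coz L).inf_mem _ hx' _ (mem_coz_of_isComplemented hc), inf_le_right⟩
    · exact h2 ⟨(Coz L).inf_mem _ hx' _ (mem_coz_of_isComplemented (isComplemented_compl hc)),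
        inf_le_right⟩

theorem isCoole_iff_isCoole_lindelofication (hL : IsStronglyZeroDimensional L) :
    IsCoole L ↔ IsCoole (Lindelofication L) := by
  refine isCoole_iff_of_dense hL (lindeloficationHom L) (fun I hI => ?_) fun c hc =>
    ⟨sigmaIdealBelow c, isComplemented_sigmaIdealBelow hc, le_antisymm
      (sSup_le fun _ hx => hx.2) (le_sSup ⟨mem_coz_of_isComplemented hc, le_rfl⟩)⟩
  refine le_bot_iff.1 fun x hx => ?_
  obtain rfl : x = ⊥ := le_bot_iff.1 ((le_sSup hx).trans (le_of_eq hI))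
  simpa using (⊥ : Lindelofication L).sSup_mem ∅ (Set.empty_subset _) Set.countable_empty

end Lindelof

/-! ### The compact coreflection -/

section Compact

variable {L : Type u} [Order.Frame L]

theorem sSup_le_iff_le_principal {I : Order.Ideal L} {a : L} :
    sSup (I : Set L) ≤ a ↔ I ≤ Order.Ideal.principal a :=
  sSup_le_iff

variable (L) in
/-- The dense frame map `βL → L`, `I ↦ ⋁ I`. -/
def compactificationHom : FrameHom (Compactification L) L where
  toFun I := sSup (I.1 : Set L)
  map_inf' I J := by
    refine le_antisymm (le_inf (sSup_le_sSup fun _ hx => hx.1) (sSup_le_sSup fun _ hx => hx.2)) ?_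
    rw [sSup_inf_sSup]
    exact iSup₂_le fun p hp => le_sSup ⟨I.1.lower inf_le_left hp.1, J.1.lower inf_le_right hp.2⟩
  map_top' := by
    let T : Compactification L :=
      ⟨Order.Ideal.principal ⊤, fun x hx => ⟨⊤, le_rfl, completelyBelow_top x⟩⟩
    exact top_le_iff.1 <| le_sSup <| (le_top : T ≤ ⊤) (show (⊤ : L) ≤ ⊤ from le_rfl)
  map_sSup' s := by
    -- Joins of regular ideals are joins of ideals.
    refine eq_of_forall_ge_iff fun a => ?_
    rw [sSup_le_iff_le_principal,
      show (sSup s : Compactification L).1 = sSup (Subtype.val '' s) from rfl,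
      sSup_le_iff, sSup_le_iff]
    constructor
    · rintro h _ ⟨I, hI, rfl⟩
      exact sSup_le_iff_le_principal.2 (h _ ⟨I, hI, rfl⟩)
    · rintro h _ ⟨I, hI, rfl⟩
      exact sSup_le_iff_le_principal.1 (h _ ⟨I, hI, rfl⟩)

/-- The principal ideal of a complemented element, which is regular. -/
def regularPrincipal (c : L) (hc : IsComplemented c) : Compactification L :=
  ⟨Order.Ideal.principal c, fun _ hx =>
    ⟨c, le_rfl, (completelyBelow_self_of_isComplemented hc).mono hx le_rfl⟩⟩

theorem isComplemented_regularPrincipal {c : L} (hc : IsComplemented c) :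
    IsComplemented (regularPrincipal c hc) := by
  refine ⟨regularPrincipal cᶜ (isComplemented_compl hc), disjoint_iff_inf_le.2 fun x hx => ?_,
    fun K h1 h2 x _ => ?_⟩
  · obtain rfl : x = ⊥ := le_bot_iff.1 <| (le_inf hx.1 hx.2).trans (inf_compl_self c).le
    exact Order.Ideal.bot_mem _
  · refine K.1.lower ?_ (Order.Ideal.sup_mem (h1 (show c ≤ c from le_rfl))
      (h2 (show cᶜ ≤ cᶜ from le_rfl)))
    rw [(isCompl_compl_of_isComplemented hc).sup_eq_top]
    exact le_top

theorem isCoole_iff_isCoole_compactification (hL : IsStronglyZeroDimensional L) :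
    IsCoole L ↔ IsCoole (Compactification L) := by
  refine isCoole_iff_of_dense hL (compactificationHom L) (fun I hI => ?_) fun c hc =>
    ⟨regularPrincipal c hc, isComplemented_regularPrincipal hc, le_antisymm
      (sSup_le fun _ hx => hx) (le_sSup (show c ≤ c from le_rfl))⟩
  refine le_bot_iff.1 fun x hx => ?_
  obtain rfl : x = ⊥ := le_bot_iff.1 ((le_sSup hx).trans (le_of_eq hI))
  exact Order.Ideal.bot_mem _

end Compact

end FrameBases

open FrameBases
theorem theorem6p16 {L : Type*} [Order.Frame L] (hL : IsStronglyZeroDimensional L) :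
    List.TFAE
      [IsCoole L,
       (DSigma (Complementeds L)).carrier = Set.univ,
       PosetIsFrame (boolz (Coz L).carrier),
       IsCoole (Lindelofication L),
       IsCoole (Compactification L)] := by
  tfae_have 1 ↔ 2 := isCoole_iff_dSigma hL
  tfae_have 1 ↔ 3 := isCoole_iff_posetIsFrame hL.1
  tfae_have 1 ↔ 4 := isCoole_iff_isCoole_lindelofication hL
  tfae_have 1 ↔ 5 := isCoole_iff_isCoole_compactification hL
  tfae_finish
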